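/- Let $\Omega$ be a finite commutative ring with an isomorphism $\Omega\cong R_1\times\cdots\times R_k$, $k\ge 1$, where every $R_i$ is a finite local ring that is not a field, and let $u_i=|U(R_i)|$ be the number of units of $R_i$. Let $K_0(\Omega)$ be the simplicial complex whose simplices are the finite sets $A\subseteq\Omega\setminus\{0\}$ such that $xy=0$ for all distinct $x,y\in A$, and let $K(\Omega)$ be its full subcomplex on the nonzero zero-divisors of $\Omega$, that is, the clique complex of the zero-divisor graph of $\Omega$. Let $\tilde H_n$ denote reduced simplicial homology with integer coefficients. There are integers $a_{n,k}$ ($n\ge 0$, $k\ge 1$), not depending on the rings, with $$a_{0,k}=1\quad(k\ge1),\qquad a_{n,k}=\sum_{j=1}^{k-1}\binom{k-1}{j}\,a_{n-1,j}\quad(n\ge 1,\ k\ge 1),$$ such that for all $k$, $\Omega$ and $R_1,\dots,R_k$ as above $$\operatorname{rank}\tilde H_n(K(\Omega))=a_{n,k}\,u_1u_2\cdots u_k\qquad\text{for all } n\ge 1,$$ $$\operatorname{rank}\tilde H_n(K_0(\Omega))=a_{n,k}\,u_1u_2\cdots u_k\qquad\text{for all } n\ge 0,$$ and $\operatorname{rank}\tilde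 H_0(K(\Omega))=0$. -/

import Mathlib

open Finset

noncomputable section

namespace ZeroDivisorHomology

/-! ### Reduced simplicial homology with integer coefficients

The vertices are totally ordered, and every simplex carries the orientation given by the increasing
order of its vertices.  An integral chain is a finite formal sum of finite sets of vertices. -/

section Homology

variable {V : Type*} [LinearOrder V]

/-- The boundary of one oriented simplex: if `s = {v₀ < v₁ < ⋯ < vₘ}` then
`∂ s = ∑ᵢ (-1)^i [v₀, …, v̂ᵢ, …, vₘ]`, where `i` is the number of vertices of `s` below `vᵢ`.
On a single vertex this is the augmentation: `∂ {v} = ∅`. -/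
def faceSum (s : Finset V) : Finset V →₀ ℤ :=
  ∑ x ∈ s, Finsupp.single (s.erase x) ((-1 : ℤ) ^ #{y ∈ s | y < x})

variable (V) in
/-- The linear extension of the boundary to all formal sums. -/
def boundaryMap : (Finset V →₀ ℤ) →ₗ[ℤ] (Finset V →₀ ℤ) :=
  Finsupp.linearCombination ℤ faceSum

theorem boundaryMap_single (s : Finset V) (c : ℤ) :
    boundaryMap V (Finsupp.single s c) = c • faceSum s := by
  simp [boundaryMap]

/-- `chains K m` is the group of chains of simplices of `K` that have exactly `m` vertices, that is,
of dimension `m - 1`.  For `m = 0` the only one is the empty simplex, so that this is `ℤ`, in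
dimension `-1`: the chains form the augmented chain complex. -/
def chains (K : PreAbstractSimplicialComplex V) (m : ℕ) : Submodule ℤ (Finset V →₀ ℤ) :=
  Finsupp.supported ℤ ℤ {s : Finset V | (s ∈ K ∨ s = ∅) ∧ #s = m}

/-- The `n`-dimensional cycles of the augmented chain complex (`n ≥ 0`). -/
def reducedCycles (K : PreAbstractSimplicialComplex V) (n : ℕ) : Submodule ℤ (Finset V →₀ ℤ) :=
  chains K (n + 1) ⊓ LinearMap.ker (boundaryMap V)

/-- The `n`-dimensional boundaries of the augmented chain complex (`n ≥ 0`). -/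
def reducedBoundaries (K : PreAbstractSimplicialComplex V) (n : ℕ) :
    Submodule ℤ (Finset V →₀ ℤ) :=
  (chains K (n + 2)).map (boundaryMap V)

theorem boundaryMap_faceSum (s : Finset V) : boundaryMap V (faceSum s) = 0 := by
  have key : ∀ x ∈ s, ∀ y ∈ s, x < y →
      (-1 : ℤ) ^ #{z ∈ s | z < x} * (-1 : ℤ) ^ #{z ∈ s.erase x | z < y} +
      (-1 : ℤ) ^ #{z ∈ s | z < y} * (-1 : ℤ) ^ #{z ∈ s.erase y | z < x} = 0 := by
    intro x hx y hy hxy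
    have h1 : {z ∈ s | z < y} = insert x {z ∈ s.erase x | z < y} := by
      ext z; simp only [mem_filter, mem_insert, mem_erase]; grind
    have h2 : {z ∈ s.erase y | z < x} = {z ∈ s | z < x} := by
      ext z; simp only [mem_filter, mem_erase]; grind
    rw [h1, h2, card_insert_of_notMem (by simp)]
    ring
  simp only [faceSum, map_sum, boundaryMap_single, smul_sum, Finsupp.smul_single, smul_eq_mul]
  rw [Finset.sum_sigma']
  refine Finset.sum_involution (fun p _ => ⟨p.2, p.1⟩) ?_ ?_ ?_ ?_
  · rintro ⟨x, y⟩ h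
    simp only [mem_sigma, mem_erase] at h
    obtain ⟨hx, hyx, hy⟩ := h
    rw [Finset.erase_right_comm (a := x), ← Finsupp.single_add]
    rcases lt_or_gt_of_ne hyx with h | h
    · rw [add_comm, key y hy x hx h, Finsupp.single_zero]
    · rw [key x hx y hy h, Finsupp.single_zero]
  · rintro ⟨x, y⟩ h _ heq
    simp only [mem_sigma, mem_erase] at h
    simp only [Sigma.mk.injEq] at heq
    exact h.2.1 heq.1
  · rintro ⟨x, y⟩ h
    simp only [mem_sigma, mem_erase] at h ⊢
    exact ⟨h.2.2, fun e => h.2.1 e.symm, h.1⟩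
  · rintro ⟨x, y⟩ h
    rfl

theorem reducedBoundaries_le_reducedCycles (K : PreAbstractSimplicialComplex V) (n : ℕ) :
    reducedBoundaries K n ≤ reducedCycles K n := by
  rw [reducedBoundaries, chains, Finsupp.supported_eq_span_single, Submodule.map_span,
    Submodule.span_le]
  rintro _ ⟨_, ⟨s, ⟨hs, hc⟩, rfl⟩, rfl⟩
  simp only [boundaryMap_single, one_smul]
  refine ⟨?_, boundaryMap_faceSum s⟩
  refine Submodule.sum_mem _ fun x hx => Finsupp.single_mem_supported ℤ _ ?_
  have hcard : #(s.erase x) = n + 1 := by rw [card_erase_of_mem hx, hc]; rfl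
  have hne : (s.erase x).Nonempty := by rw [← card_pos, hcard]; omega
  refine ⟨Or.inl ?_, hcard⟩
  rcases hs with hs | rfl
  · exact (K.isRelLowerSet_faces hs).2 (erase_subset x s) hne
  · simp at hx

/-- The reduced simplicial homology group `H̃ₙ(K) = ker ∂ₙ / im ∂ₙ₊₁` for `n ≥ 0`. -/
abbrev ReducedHomology (K : PreAbstractSimplicialComplex V) (n : ℕ) : Type _ :=
  reducedCycles K n ⧸ (reducedBoundaries K n).submoduleOf (reducedCycles K n)

/-- The `n`-th (reduced) Betti number: the rank of the abelian group `H̃ₙ(K)`. -/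
def reducedBetti (K : PreAbstractSimplicialComplex V) (n : ℕ) : ℕ :=
  Module.finrank ℤ (ReducedHomology K n)

end Homology

/-! ### Zero-divisor graphs and their clique complexes -/

/-- The clique complex of the subgraph of `G` induced on the set `S`: its simplices are the nonempty
finite cliques of `G` all of whose vertices lie in `S`. -/
def inducedCliqueComplex {V : Type*} (G : SimpleGraph V) (S : Set V) :
    PreAbstractSimplicialComplex V where
  faces := {s | s.Nonempty ∧ (s : Set V) ⊆ S ∧ G.IsClique (s : Set V)}
  isRelLowerSet_faces := by
    rintro s ⟨hs, hS, hG⟩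
    refine ⟨hs, fun t hts ht => ⟨ht, ?_, ?_⟩⟩
    · exact (Finset.coe_subset.2 hts).trans hS
    · exact hG.subset (Finset.coe_subset.2 hts)

/-- Beck's graph on all elements of a ring: distinct `a`, `b` are adjacent iff `a * b = 0`. -/
def beckGraph (A : Type*) [CommRing A] : SimpleGraph A where
  Adj a b := a ≠ b ∧ a * b = 0
  symm := ⟨fun a b h => ⟨h.1.symm, by rw [mul_comm]; exact h.2⟩⟩
  loopless := ⟨fun _ h => h.1 rfl⟩

/-- The set of nonzero zero-divisors of a ring. -/
def nonzeroZeroDivisors (A : Type*) [CommRing A] : Set A :=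
  {a | a ≠ 0 ∧ ∃ b, b ≠ 0 ∧ a * b = 0}

/-- `K(A)`: the clique complex of the zero-divisor graph, the subgraph of Beck's graph induced on
the nonzero zero-divisors. -/
def zeroDivisorComplex (A : Type*) [CommRing A] : PreAbstractSimplicialComplex A :=
  inducedCliqueComplex (beckGraph A) (nonzeroZeroDivisors A)

/-- `K₀(A)`: its simplices are the nonempty finite sets of nonzero elements of `A` such that
`x * y = 0` for all distinct members `x`, `y`. -/
def nonzeroComplex (A : Type*) [CommRing A] : PreAbstractSimplicialComplex A :=
  inducedCliqueComplex (beckGraph A) {a | a ≠ 0}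

end ZeroDivisorHomology

end

/-! Let `s i` be a nonzero element of `R i` annihilated by the maximal ideal, and let `z i` have
coordinate `s i` at `i` and zero elsewhere. Then `z i` annihilates every element whose `i`-th
coordinate is a nonunit, and no coordinate of `z i` is a unit. So the simplices without a unit at
coordinate `i` form a cone with apex `z i`, and every apex lies in all these cones. Their union is
therefore acyclic (`exists_boundaryMap_eq_of_cones`).

Call the remaining simplices critical: every coordinate is a unit at some vertex. If a face obtained
by deleting `x` were still critical, units at the other vertices would force each coordinate of `x`
to vanish, so `x = 0`. Modulo the acyclic part the differential is thus zero, and homology is free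
on the critical simplices (`reducedBetti_eq_card_of_cones`).

In a critical simplex a unit coordinate kills that coordinate of all other vertices. Hence
coordinates are zero or units, and the unit supports partition the index set. With `n + 1` vertices
this gives S(k, n+1) · ∏ uᵢ simplices, so a_{n,k} is the Stirling number S(k, n+1) of the second
kind. -/

noncomputable section

namespace ZeroDivisorHomology

/-! ### Cones, acyclic unions of cones, and homology relative to them. -/

section Cone

variable {V : Type*} [LinearOrder V]

/-- The cone with apex `v` over one oriented simplex; zero if `v` is already a vertex. -/
def coneFace (v : V) (s : Finset V) : Finset V →₀ ℤ :=
  if v ∈ s then 0 else Finsupp.single (insert v s) ((-1 : ℤ) ^ #{y ∈ s | y < v})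

/-- The linear extension of the cone operator with apex `v` to all formal sums. -/
def coneMap (v : V) : (Finset V →₀ ℤ) →ₗ[ℤ] (Finset V →₀ ℤ) :=
  Finsupp.linearCombination ℤ (coneFace v)

theorem coneMap_single (v : V) (s : Finset V) (c : ℤ) :
    coneMap v (Finsupp.single s c) = c • coneFace v s := by
  simp [coneMap]

/-- If `v ∈ s`, only the face opposite `v` survives coning. Otherwise the faces of the cone through
`v` cancel the cones over the faces of `s`, and the face opposite `v` remains. -/
theorem boundaryMap_coneFace_add (v : V) (s : Finset V) :
    boundaryMap V (coneFace v s) + coneMap v (faceSum s) = Finsupp.single s 1 := by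
  by_cases hv : v ∈ s
  · simp only [coneFace, hv, if_true, map_zero, zero_add, faceSum, map_sum, coneMap_single]
    rw [Finset.sum_eq_single v]
    · have h : {y ∈ s.erase v | y < v} = {y ∈ s | y < v} := by ext z; grind
      rw [if_neg (by simp), insert_erase hv, h, Finsupp.smul_single, smul_eq_mul, ← mul_pow]
      simp
    · intro x hx hxv
      rw [if_pos (mem_erase.2 ⟨hxv.symm, hv⟩), smul_zero]
    · exact fun h => absurd hv h
  · simp only [coneFace, hv, if_false, boundaryMap_single, faceSum, map_sum, coneMap_single]
    rw [sum_insert hv, erase_insert hv, smul_add, add_assoc, smul_sum, ← sum_add_distrib,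
      sum_eq_zero, add_zero]
    · have h : {y ∈ insert v s | y < v} = {y ∈ s | y < v} := by ext z; grind
      rw [h, Finsupp.smul_single, smul_eq_mul, ← mul_pow]
      simp
    · intro x hx
      have hne : v ≠ x := by rintro rfl; exact hv hx
      rw [if_neg (fun h => hv (mem_of_mem_erase h)), erase_insert_of_ne hne,
        Finsupp.smul_single, Finsupp.smul_single, ← Finsupp.single_add, smul_eq_mul, smul_eq_mul]
      rw [Finsupp.single_eq_zero]
      rcases lt_or_gt_of_ne hne with h | h
      · have h1 : {y ∈ insert v s | y < x} = insert v {y ∈ s | y < x} := by ext z; grind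
        have h2 : {y ∈ s.erase x | y < v} = {y ∈ s | y < v} := by ext z; grind
        rw [h1, h2, card_insert_of_notMem (by simp [hv])]
        ring
      · have h1 : {y ∈ insert v s | y < x} = {y ∈ s | y < x} := by ext z; grind
        have h2 : {y ∈ s | y < v} = insert x {y ∈ s.erase x | y < v} := by ext z; grind
        rw [h1, h2, card_insert_of_notMem (by simp)]
        ring

/-- The cone operator contracts the chain complex of all formal sums. -/
theorem boundaryMap_coneMap_add (v : V) (c : Finset V →₀ ℤ) :
    boundaryMap V (coneMap v c) + coneMap v (boundaryMap V c) = c := by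
  induction c using Finsupp.induction_linear with
  | zero => simp
  | add f g hf hg =>
    simp only [map_add]
    nth_rewrite 3 [← hf]
    nth_rewrite 3 [← hg]
    abel
  | single s a =>
    rw [coneMap_single, boundaryMap_single, map_smul, map_smul, ← smul_add,
      boundaryMap_coneFace_add]
    simp

theorem boundaryMap_boundaryMap (c : Finset V →₀ ℤ) : boundaryMap V (boundaryMap V c) = 0 := by
  induction c using Finsupp.induction_linear with
  | zero => simp
  | add f g hf hg => simp [hf, hg]
  | single s a => rw [boundaryMap_single, map_smul, boundaryMap_faceSum, smul_zero]

theorem boundaryMap_mem_supported {S T : Set (Finset V)} (h : ∀ s ∈ S, ∀ x ∈ s, s.erase x ∈ T)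
    {c : Finset V →₀ ℤ} (hc : c ∈ Finsupp.supported ℤ ℤ S) :
    boundaryMap V c ∈ Finsupp.supported ℤ ℤ T := by
  rw [boundaryMap, Finsupp.linearCombination_apply]
  exact Submodule.sum_mem _ fun s hs => Submodule.smul_mem _ _ <|
    Submodule.sum_mem _ fun x hx => Finsupp.single_mem_supported ℤ _ (h s (hc hs) x hx)

theorem coneMap_mem_supported {v : V} {S T : Set (Finset V)}
    (h : ∀ s ∈ S, v ∉ s → insert v s ∈ T)
    {c : Finset V →₀ ℤ} (hc : c ∈ Finsupp.supported ℤ ℤ S) :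
    coneMap v c ∈ Finsupp.supported ℤ ℤ T := by
  rw [coneMap, Finsupp.linearCombination_apply]
  refine Submodule.sum_mem _ fun s hs => Submodule.smul_mem _ _ ?_
  rw [coneFace]
  split_ifs with hv
  · exact Submodule.zero_mem _
  · exact Finsupp.single_mem_supported ℤ _ (h s (hc hs) hv)

/-- If a family of simplices is a union of cones, such that every apex lies in all the cones, then
its augmented chain complex is acyclic. -/
theorem exists_boundaryMap_eq_of_cones {ι : Type*} {A : Set (Finset V)}
    (hA : ∀ s ∈ A, ∀ x ∈ s, s.erase x ∈ A) {E : ι → V → Prop} {z : ι → V}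
    (hz : ∀ i j, E i (z j)) (hins : ∀ i, ∀ s ∈ A, (∀ x ∈ s, E i x) → insert (z i) s ∈ A)
    (m : ℕ) (J : Finset ι) (c : Finset V →₀ ℤ)
    (hc : c ∈ Finsupp.supported ℤ ℤ {s | s ∈ A ∧ #s = m ∧ ∃ i ∈ J, ∀ x ∈ s, E i x})
    (hc0 : boundaryMap V c = 0) :
    ∃ d ∈ Finsupp.supported ℤ ℤ {s | s ∈ A ∧ #s = m + 1 ∧ ∃ i ∈ J, ∀ x ∈ s, E i x},
      boundaryMap V d = c := by
  classical
  induction J using Finset.induction_on generalizing c with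
  | empty =>
    have : c = 0 := by
      simpa [Finsupp.supported_empty] using hc
    exact ⟨0, Submodule.zero_mem _, by simp [this]⟩
  | insert i J hi ih =>
    set c₁ := c.filter (fun s => ∀ x ∈ s, E i x) with hc₁
    set c₂ := c.filter (fun s => ¬ ∀ x ∈ s, E i x) with hc₂
    have hsum : c₁ + c₂ = c := Finsupp.filter_add_filter_not c _
    have h₁ : c₁ ∈ Finsupp.supported ℤ ℤ {s | s ∈ A ∧ #s = m ∧ ∀ x ∈ s, E i x} := by
      intro s hs
      rw [hc₁, Finsupp.support_filter, mem_coe, mem_filter] at hs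
      exact ⟨(hc hs.1).1, (hc hs.1).2.1, hs.2⟩
    have h₂ : c₂ ∈ Finsupp.supported ℤ ℤ {s | s ∈ A ∧ #s = m ∧ ∃ i ∈ J, ∀ x ∈ s, E i x} := by
      intro s hs
      rw [hc₂, Finsupp.support_filter, mem_coe, mem_filter] at hs
      obtain ⟨h, h', j, hj, hE⟩ := hc hs.1
      refine ⟨h, h', j, (mem_insert.1 hj).resolve_left ?_, hE⟩
      rintro rfl
      exact hs.2 hE
    -- Since `c` is a cycle, `∂c₁ = -∂c₂` lies both in cone `i` and in the cones of `J`. Its cone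
    -- from `z i` stays in the latter because `z i` belongs to all of them.
    have h₃ : boundaryMap V c₁ ∈ Finsupp.supported ℤ ℤ
        ({s | s ∈ A ∧ #s + 1 = m ∧ ∀ x ∈ s, E i x} ∩
          {s | s ∈ A ∧ #s + 1 = m ∧ ∃ i ∈ J, ∀ x ∈ s, E i x}) := by
      rw [Finsupp.supported_inter]
      refine ⟨boundaryMap_mem_supported ?_ h₁, ?_⟩
      · rintro s ⟨hs, hm, hE⟩ x hx
        exact ⟨hA s hs x hx, by rw [card_erase_add_one hx, hm],
          fun y hy => hE y (mem_of_mem_erase hy)⟩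
      · have : boundaryMap V c₁ = - boundaryMap V c₂ := by
          rw [eq_neg_iff_add_eq_zero, ← map_add, hsum, hc0]
        rw [this]
        refine Submodule.neg_mem _ (boundaryMap_mem_supported ?_ h₂)
        rintro s ⟨hs, hm, j, hj, hE⟩ x hx
        exact ⟨hA s hs x hx, by rw [card_erase_add_one hx, hm], j, hj,
          fun y hy => hE y (mem_of_mem_erase hy)⟩
    have h₄ : coneMap (z i) (boundaryMap V c₁) ∈
        Finsupp.supported ℤ ℤ {s | s ∈ A ∧ #s = m ∧ ∃ i ∈ J, ∀ x ∈ s, E i x} := by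
      refine coneMap_mem_supported ?_ h₃
      rintro s ⟨⟨hs, hm, hE⟩, -, -, j, hj, hE'⟩ hv
      exact ⟨hins i s hs hE, by rw [card_insert_of_notMem hv, hm], j, hj,
        forall_mem_insert _ _ _ |>.2 ⟨hz j i, hE'⟩⟩
    have key := boundaryMap_coneMap_add (z i) c₁
    -- This chain is `c - ∂(coneMap (z i) c₁)`: a cycle homologous to `c` that avoids cone `i`'s own
    -- simplices, so induction applies.
    obtain ⟨d, hd, hdc⟩ := ih (c₂ + coneMap (z i) (boundaryMap V c₁))
      (Submodule.add_mem _ h₂ h₄) (by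
        have : c₂ + coneMap (z i) (boundaryMap V c₁) = c - boundaryMap V (coneMap (z i) c₁) := by
          rw [← hsum]; nth_rewrite 2 [← key]; abel
        rw [this, map_sub, hc0, boundaryMap_boundaryMap, sub_zero])
    refine ⟨coneMap (z i) c₁ + d, Submodule.add_mem _ ?_ ?_, ?_⟩
    · refine coneMap_mem_supported ?_ h₁
      rintro s ⟨hs, hm, hE⟩ hv
      exact ⟨hins i s hs hE, by rw [card_insert_of_notMem hv, hm], i, mem_insert_self _ _,
        forall_mem_insert _ _ _ |>.2 ⟨hz i i, hE⟩⟩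
    · refine Finsupp.supported_mono ?_ hd
      rintro s ⟨hs, hm, j, hj, hE⟩
      exact ⟨hs, hm, j, mem_insert_of_mem hj, hE⟩
    · rw [map_add, hdc, ← hsum]
      nth_rewrite 3 [← key]
      abel

/-- Suppose that the simplices of `K` lying in one of finitely many cones form an acyclic complex as
in `exists_boundaryMap_eq_of_cones`, and that the proper faces of every other simplex lie in one of
the cones. Then the Betti numbers of `K` count the other simplices. -/
theorem reducedBetti_eq_card_of_cones {ι : Type*} [Finite ι] [Finite V]
    (K : PreAbstractSimplicialComplex V) {E : ι → V → Prop} {z : ι → V}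
    (hz : ∀ i j, E i (z j))
    (hins : ∀ i s, (s ∈ K ∨ s = ∅) → (∀ x ∈ s, E i x) → insert (z i) s ∈ K)
    (hcrit : ∀ s ∈ K, ∀ x ∈ s, ∃ i, ∀ y ∈ s.erase x, E i y) (hι : Nonempty ι) (n : ℕ) :
    reducedBetti K n =
      Nat.card {s : Finset V // (s ∈ K ∧ ∀ i, ∃ x ∈ s, ¬ E i x) ∧ #s = n + 1} := by
  classical
  have := Fintype.ofFinite ι
  have := Fintype.ofFinite V
  set A : Set (Finset V) := {s | s ∈ K ∨ s = ∅} with hAdef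
  have hA : ∀ s ∈ A, ∀ x ∈ s, s.erase x ∈ A := by
    rintro s hs x hx
    rcases (s.erase x).eq_empty_or_nonempty with h | h
    · exact Or.inr h
    · rcases hs with hs | rfl
      · exact Or.inl ((K.isRelLowerSet_faces hs).2 (erase_subset x s) h)
      · simp at hx
  have hface : ∀ s ∈ A, ∀ x ∈ s, ∃ i, ∀ y ∈ s.erase x, E i y := by
    rintro s (hs | rfl) x hx
    · exact hcrit s hs x hx
    · simp at hx
  have acyc : ∀ m (c : Finset V →₀ ℤ), c ∈ chains K m →
      (∀ s, (s ∈ K ∧ ∀ i, ∃ x ∈ s, ¬ E i x) ∧ #s = m → c s = 0) → boundaryMap V c = 0 →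
      ∃ d ∈ Finsupp.supported ℤ ℤ {s | s ∈ A ∧ #s = m + 1 ∧ ∃ i, ∀ x ∈ s, E i x},
        boundaryMap V d = c := by
    intro m c hc hcr hc0
    have := exists_boundaryMap_eq_of_cones hA hz (fun i s hs h => Or.inl (hins i s hs h)) m
      Finset.univ c ?_ hc0
    · simpa using this
    · intro s hs
      obtain ⟨hs1, hm⟩ := hc hs
      refine ⟨hs1, hm, ?_⟩
      by_contra! h
      rcases hs1 with hs1 | rfl
      · exact (Finsupp.mem_support_iff.1 hs) (hcr s ⟨⟨hs1, by simpa using h⟩, hm⟩)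
      -- The empty simplex lies in every cone, but some cone must exist.
      · obtain ⟨i⟩ := hι
        simpa using h i
  -- Restriction of a cycle to its coefficients on critical simplices. Boundaries die because proper
  -- faces lie in cones; a cycle that dies lies in the acyclic union of cones, so it bounds.
  let φ : reducedCycles K n →ₗ[ℤ]
      ({s : Finset V | (s ∈ K ∧ ∀ i, ∃ x ∈ s, ¬ E i x) ∧ #s = n + 1} →₀ ℤ) :=
    (Finsupp.lsubtypeDomain _) ∘ₗ (reducedCycles K n).subtype
  have hφ : ∀ c s, φ c s = (c : Finset V →₀ ℤ) s := fun c s => rfl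
  have hker : (reducedBoundaries K n).submoduleOf (reducedCycles K n) = LinearMap.ker φ := by
    ext ⟨c, hc⟩
    rw [Submodule.submoduleOf, Submodule.mem_comap, LinearMap.mem_ker]
    constructor
    · rintro ⟨d, hd, hdc⟩
      have hsupp := boundaryMap_mem_supported (T := {s | ∃ i, ∀ y ∈ s, E i y})
        (fun s hs x hx => hface s hs.1 x hx) hd
      rw [hdc] at hsupp
      ext ⟨s, hs⟩
      rw [hφ]
      by_contra h
      obtain ⟨i, hi⟩ := hsupp (Finsupp.mem_support_iff.2 h)
      obtain ⟨x, hx, hxE⟩ := hs.1.2 i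
      exact hxE (hi x hx)
    · intro h
      obtain ⟨d, hd, hdc⟩ := acyc (n + 1) c hc.1
        (fun s hs => (hφ _ _).symm.trans (DFunLike.congr_fun h ⟨s, hs⟩)) hc.2
      exact ⟨d, fun s hs => ⟨(hd hs).1, (hd hs).2.1⟩, hdc⟩
  have hsurj : Function.Surjective φ := by
    rw [← LinearMap.range_eq_top, eq_top_iff]
    intro f _
    induction f using Finsupp.induction_linear with
    | zero => exact Submodule.zero_mem _
    | add f g hf hg => exact Submodule.add_mem _ (hf trivial) (hg trivial)
    | single s a =>
      obtain ⟨s, hs⟩ := s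
      have hbd : boundaryMap V (Finsupp.single s a) ∈
          Finsupp.supported ℤ ℤ {t | (t ∈ A ∧ #t = n) ∧ ∃ i, ∀ y ∈ t, E i y} := by
        refine boundaryMap_mem_supported (S := {s}) ?_ (Finsupp.single_mem_supported ℤ _ rfl)
        rintro _ rfl x hx
        refine ⟨⟨hA _ (Or.inl hs.1.1) x hx, ?_⟩, hcrit _ hs.1.1 x hx⟩
        rw [card_erase_of_mem hx, hs.2]; rfl
      -- The boundary of a critical simplex also bounds a chain `d` inside the cones; subtracting
      -- `d` completes the simplex to a cycle without changing critical coefficients.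
      obtain ⟨d, hd, hdc⟩ := acyc n (boundaryMap V (Finsupp.single s a))
        (Finsupp.supported_mono (fun t ht => ht.1) hbd)
        (fun t ht => by
          by_contra h
          obtain ⟨-, i, hi⟩ := hbd (Finsupp.mem_support_iff.2 h)
          obtain ⟨x, hx, hxE⟩ := ht.1.2 i
          exact hxE (hi x hx)) (boundaryMap_boundaryMap _)
      refine ⟨⟨Finsupp.single s a - d, Submodule.sub_mem _ ?_ ?_, ?_⟩, ?_⟩
      · exact Finsupp.single_mem_supported ℤ _ ⟨Or.inl hs.1.1, hs.2⟩
      · exact fun t ht => ⟨(hd ht).1, (hd ht).2.1⟩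
      · rw [SetLike.mem_coe, LinearMap.mem_ker, map_sub, hdc, sub_self]
      · ext ⟨t, ht⟩
        rw [hφ]
        have hdt : d t = 0 := by
          by_contra h
          obtain ⟨-, -, i, hi⟩ := hd (Finsupp.mem_support_iff.2 h)
          obtain ⟨x, hx, hxE⟩ := ht.1.2 i
          exact hxE (hi x hx)
        simp [hdt, Finsupp.single_apply]
  rw [reducedBetti, ((Submodule.quotEquivOfEq _ _ hker).trans
    (φ.quotKerEquivOfSurjective hsurj)).finrank_eq, Module.finrank_finsupp_self,
    Nat.card_eq_fintype_card]
  rfl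

end Cone

/-! ### Set partitions weighted by the number of elements with a given support. -/

section Counting

/-- The number of partitions of a set with `k` elements into `m` nonempty blocks, computed by the
recurrence that removes the block of a given element. -/
def partitionCount : ℕ → ℕ → ℕ
  | 0, k => if k = 0 then 1 else 0
  | _ + 1, 0 => 0
  | m + 1, k + 1 => ∑ j ∈ range (k + 1), k.choose j * partitionCount m j

theorem partitionCount_one {k : ℕ} (hk : 1 ≤ k) : partitionCount 1 k = 1 := by
  obtain ⟨k, rfl⟩ := Nat.exists_eq_add_of_le' hk
  simp [partitionCount]

theorem partitionCount_add_two (n : ℕ) {k : ℕ} (hk : 1 ≤ k) :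
    partitionCount (n + 2) k =
      ∑ j ∈ Icc 1 (k - 1), (k - 1).choose j * partitionCount (n + 1) j := by
  obtain ⟨k, rfl⟩ := Nat.exists_eq_add_of_le' hk
  rw [partitionCount, add_tsub_cancel_right]
  symm
  refine sum_subset (fun j hj => ?_) fun j hj hj' => ?_
  · simp only [mem_Icc] at hj
    simp only [mem_range]; omega
  -- The extra summand `j = 0` vanishes: the empty set has no partition into a positive number of
  -- blocks.
  · obtain rfl : j = 0 := by
      simp only [mem_Icc, mem_range] at hj hj'; omega
    simp [partitionCount]

variable {ι B : Type*} [DecidableEq ι]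

open Classical in
/-- The sets of `m` elements of `X` whose supports are nonempty and form a partition of `T`. -/
def supportPartitions (X : Finset B) (supp : B → Finset ι) (T : Finset ι) (m : ℕ) :
    Finset (Finset B) :=
  {σ ∈ X.powerset | (σ : Set B).PairwiseDisjoint supp ∧ (∀ x ∈ σ, (supp x).Nonempty) ∧
    σ.biUnion supp = T ∧ #σ = m}

theorem mem_supportPartitions {X : Finset B} {supp : B → Finset ι} {T : Finset ι} {m : ℕ}
    {σ : Finset B} : σ ∈ supportPartitions X supp T m ↔
      σ ⊆ X ∧ (σ : Set B).PairwiseDisjoint supp ∧ (∀ x ∈ σ, (supp x).Nonempty) ∧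
        σ.biUnion supp = T ∧ #σ = m := by
  simp [supportPartitions]

/-- Exactly one member `x` has `a` in its support. Removing it leaves a family partitioning some `U
⊆ T`, and `supp x` is the complement of `U`. -/
theorem card_supportPartitions_insert [DecidableEq B] (X : Finset B) (supp : B → Finset ι) {a : ι} {T : Finset ι}
    (ha : a ∉ T) (m : ℕ) :
    #(supportPartitions X supp (insert a T) (m + 1)) =
      ∑ U ∈ T.powerset, #{x ∈ X | supp x = insert a T \ U} * #(supportPartitions X supp U m) := by
  simp_rw [← card_product]
  rw [← card_sigma]
  symm
  refine card_bij (fun p _ => insert p.2.1 p.2.2) ?_ ?_ ?_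
  · rintro ⟨U, x, σ⟩ h
    simp only [mem_sigma, mem_powerset, mem_product, mem_filter, mem_supportPartitions] at h
    obtain ⟨hU, ⟨hx, hxs⟩, hσX, hd, hne, rfl, rfl⟩ := h
    have hxσ : x ∉ σ := by
      intro h
      obtain ⟨b, hb⟩ := hne x h
      have h1 : b ∈ insert a T \ σ.biUnion supp := hxs ▸ hb
      exact (mem_sdiff.1 h1).2 (mem_biUnion.2 ⟨x, h, hb⟩)
    rw [mem_supportPartitions]
    refine ⟨insert_subset hx hσX, ?_, ?_, ?_, card_insert_of_notMem hxσ⟩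
    · rw [coe_insert, Set.pairwiseDisjoint_insert]
      refine ⟨hd, fun y hy _ => ?_⟩
      rw [hxs]
      exact disjoint_sdiff_self_left.mono_right (subset_biUnion_of_mem supp hy)
    · refine forall_mem_insert _ _ _ |>.2 ⟨⟨a, ?_⟩, hne⟩
      rw [hxs]
      exact mem_sdiff.2 ⟨mem_insert_self _ _, fun h => ha (hU h)⟩
    · rw [biUnion_insert, hxs, sdiff_union_of_subset (hU.trans (subset_insert _ _))]
  · rintro ⟨U, x, σ⟩ h ⟨U', x', σ'⟩ h' heq
    simp only [mem_sigma, mem_powerset, mem_product, mem_filter, mem_supportPartitions] at h h'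
    obtain ⟨hU, ⟨hx, hxs⟩, hσX, hd, hne, rfl, rfl⟩ := h
    obtain ⟨hU', ⟨hx', hxs'⟩, hσX', hd', hne', rfl, hm⟩ := h'
    simp only at heq
    have hax : a ∈ supp x := by
      rw [hxs]; exact mem_sdiff.2 ⟨mem_insert_self _ _, fun h => ha (hU h)⟩
    have hax' : a ∈ supp x' := by
      rw [hxs']; exact mem_sdiff.2 ⟨mem_insert_self _ _, fun h => ha (hU' h)⟩
    have hn : ∀ y, a ∈ supp y → y ∉ σ := fun y hy h => ha (hU (mem_biUnion.2 ⟨y, h, hy⟩))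
    have hn' : ∀ y, a ∈ supp y → y ∉ σ' := fun y hy h => ha (hU' (mem_biUnion.2 ⟨y, h, hy⟩))
    obtain rfl : x = x' := by
      have : x ∈ insert x' σ' := heq ▸ mem_insert_self _ _
      exact (mem_insert.1 this).resolve_right (hn' x hax)
    obtain rfl : σ = σ' := by
      rw [← erase_insert (hn x hax), heq, erase_insert (hn' x hax)]
    rfl
  · intro σ h
    rw [mem_supportPartitions] at h
    obtain ⟨hσX, hd, hne, hT, hm⟩ := h
    obtain ⟨x, hx, hax⟩ := mem_biUnion.1 (hT.symm ▸ mem_insert_self a T)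
    have hdx : Disjoint (supp x) ((σ.erase x).biUnion supp) := by
      rw [disjoint_biUnion_right]
      intro y hy
      exact hd hx (mem_of_mem_erase hy) (ne_of_mem_erase hy).symm
    have hu : supp x ∪ (σ.erase x).biUnion supp = insert a T := by
      rw [← biUnion_insert, insert_erase hx, hT]
    refine ⟨⟨(σ.erase x).biUnion supp, x, σ.erase x⟩, ?_, insert_erase hx⟩
    simp only [mem_sigma, mem_powerset, mem_product, mem_filter, mem_supportPartitions]
    refine ⟨fun b hb => ?_, ⟨hσX hx, ?_⟩, (erase_subset _ _).trans hσX,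
      hd.subset (coe_subset.2 (erase_subset _ _)), fun y hy => hne y (mem_of_mem_erase hy),
      trivial, by rw [card_erase_of_mem hx, hm]; rfl⟩
    · refine (mem_insert.1 (hu ▸ mem_union_right _ hb)).resolve_left ?_
      rintro rfl
      exact disjoint_left.1 hdx hax hb
    · rw [← hu, union_sdiff_cancel_right hdx]

theorem card_supportPartitions [DecidableEq B] (X : Finset B) (supp : B → Finset ι) (w : ι → ℕ)
    (hw : ∀ T : Finset ι, #{x ∈ X | supp x = T} = ∏ i ∈ T, w i) (m : ℕ) (T : Finset ι) :
    #(supportPartitions X supp T m) = partitionCount m #T * ∏ i ∈ T, w i := by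
  induction m generalizing T with
  | zero =>
    rcases T.eq_empty_or_nonempty with rfl | hT
    · rw [show supportPartitions X supp ∅ 0 = {∅} by
        ext σ; rw [mem_supportPartitions, mem_singleton, card_eq_zero]
        constructor
        · exact fun h => h.2.2.2.2
        · rintro rfl; simp]
      simp [partitionCount]
    · rw [show supportPartitions X supp T 0 = ∅ by
        ext σ; rw [mem_supportPartitions, card_eq_zero]
        simp only [notMem_empty, iff_false]
        rintro ⟨-, -, -, h, rfl⟩
        simp only [biUnion_empty] at h
        exact hT.ne_empty h.symm]
      simp [partitionCount, hT.ne_empty]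
  | succ m ih =>
    induction T using Finset.induction_on with
    | empty =>
      rw [show supportPartitions X supp ∅ (m + 1) = ∅ by
        ext σ; rw [mem_supportPartitions]
        simp only [notMem_empty, iff_false]
        rintro ⟨-, -, hne, h, hm⟩
        obtain ⟨x, hx⟩ := card_pos.1 (by omega : 0 < #σ)
        obtain ⟨b, hb⟩ := hne x hx
        have : b ∈ σ.biUnion supp := mem_biUnion.2 ⟨x, hx, hb⟩
        simp [h] at this]
      simp [partitionCount]
    | insert a T ha _ =>
      rw [card_supportPartitions_insert X supp ha, card_insert_of_notMem ha, partitionCount,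
        sum_mul]
      have hterm : ∀ U ∈ T.powerset,
          #{x ∈ X | supp x = insert a T \ U} * #(supportPartitions X supp U m) =
            partitionCount m #U * ∏ i ∈ insert a T, w i := by
        intro U hU
        -- The weights of `U` and of its complement multiply to the full weight, so the term depends
        -- on `U` only through `#U`.
        rw [hw, ih, ← prod_sdiff ((mem_powerset.1 hU).trans (subset_insert a T))]
        ring
      rw [sum_congr rfl hterm, sum_powerset_apply_card
        (fun j => partitionCount m j * ∏ i ∈ insert a T, w i)]
      simp only [smul_eq_mul, mul_assoc]

end Counting

/-! ### Products of finite local rings and their critical cliques. -/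

section Rings

/-- A finite local ring that is not a field has a nonzero nonunit that annihilates every nonunit. -/
theorem exists_ne_zero_mul_nonunit_eq_zero (R : Type*) [CommRing R] [Finite R] [IsLocalRing R]
    (hR : ¬ IsField R) : ∃ s : R, s ≠ 0 ∧ ¬ IsUnit s ∧ ∀ y, ¬ IsUnit y → s * y = 0 := by
  classical
  have hm : IsLocalRing.maximalIdeal R ≠ ⊥ := fun h =>
    hR (IsLocalRing.isField_iff_maximalIdeal_eq.2 h)
  have hex : ∃ n, IsLocalRing.maximalIdeal R ^ n = ⊥ := by
    obtain ⟨n, hn⟩ := IsArtinianRing.isNilpotent_jacobson_bot (R := R)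
    rw [IsLocalRing.jacobson_eq_maximalIdeal _ bot_ne_top] at hn
    exact ⟨n, hn⟩
  -- The least vanishing power of the maximal ideal is not the zeroth; any nonzero `s` in the power
  -- before it is killed by all nonunits.
  obtain ⟨n, hn⟩ : ∃ n, Nat.find hex = n + 1 := by
    refine Nat.exists_eq_succ_of_ne_zero fun h => ?_
    have := Nat.find_spec hex
    rw [h, pow_zero, Ideal.one_eq_top] at this
    exact bot_ne_top this.symm
  have h0 : IsLocalRing.maximalIdeal R ^ (n + 1) = ⊥ := hn ▸ Nat.find_spec hex
  obtain ⟨s, hs, hs0⟩ := Submodule.exists_mem_ne_zero_of_ne_bot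
    (Nat.find_min hex (show n < Nat.find hex by omega))
  have hsy : ∀ y, ¬ IsUnit y → s * y = 0 := fun y hy => by
    have : s * y ∈ IsLocalRing.maximalIdeal R ^ (n + 1) :=
      pow_succ (IsLocalRing.maximalIdeal R) n ▸
        Ideal.mul_mem_mul hs ((IsLocalRing.mem_maximalIdeal y).2 hy)
    rwa [h0] at this
  refine ⟨s, hs0, fun hu => ?_, hsy⟩
  obtain ⟨y, hy, hy0⟩ := Submodule.exists_mem_ne_zero_of_ne_bot hm
  exact hy0 (hu.mul_right_eq_zero.1 (hsy y ((IsLocalRing.mem_maximalIdeal y).1 hy)))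

variable {ι : Type*} {A : Type*} [CommRing A] {R : ι → Type*} [∀ i, CommRing (R i)]

open Classical in
/-- The coordinates in which an element of a product of rings is a unit. -/
def unitSupport [Fintype ι] (e : A ≃+* ∀ i, R i) (x : A) : Finset ι := {i | IsUnit (e x i)}

open Classical in
/-- The elements of a product of rings all of whose coordinates are zero or a unit. -/
def zeroOrUnitElements [Finite A] (e : A ≃+* ∀ i, R i) : Finset A :=
  haveI := Fintype.ofFinite A
  {x | ∀ i, e x i = 0 ∨ IsUnit (e x i)}

theorem mem_unitSupport [Fintype ι] {e : A ≃+* ∀ i, R i} {x : A} {i : ι} :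
    i ∈ unitSupport e x ↔ IsUnit (e x i) := by
  simp [unitSupport]

theorem mem_zeroOrUnitElements [Finite A] {e : A ≃+* ∀ i, R i} {x : A} :
    x ∈ zeroOrUnitElements e ↔ ∀ i, e x i = 0 ∨ IsUnit (e x i) := by
  simp [zeroOrUnitElements]

theorem card_filter_unitSupport_eq [Fintype ι] [DecidableEq ι] [Finite A] [∀ i, Finite (R i)]
    [∀ i, Nontrivial (R i)] (e : A ≃+* ∀ i, R i) (T : Finset ι) :
    #{x ∈ zeroOrUnitElements e | unitSupport e x = T} = ∏ i ∈ T, Nat.card (R i)ˣ := by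
  classical
  have := fun i => Fintype.ofFinite (R i)
  have hu : ∀ i, #{r : R i | IsUnit r} = Nat.card (R i)ˣ := fun i => by
    rw [Nat.card_congr (Equiv.ofInjective ((↑) : (R i)ˣ → R i) Units.val_injective), Nat.card_eq_fintype_card, ← Set.toFinset_card]
    congr 1
    ext r
    rw [mem_filter_univ, Set.mem_toFinset]
    rfl
  calc _ = #(Fintype.piFinset fun i => if i ∈ T then univ.filter (fun r : R i => IsUnit r) else {0}) := by
        refine card_equiv e.toEquiv fun x => ?_
        simp only [mem_filter, mem_zeroOrUnitElements, Fintype.mem_piFinset]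
        constructor
        · rintro ⟨h, rfl⟩ i
          split_ifs with hi
          · simpa using mem_unitSupport.1 hi
          · simpa using (h i).resolve_right fun h => hi (mem_unitSupport.2 h)
        · intro h
          have h1 : ∀ i, i ∈ T → IsUnit (e x i) := fun i hi => by simpa [hi] using h i
          have h2 : ∀ i, i ∉ T → e x i = 0 := fun i hi => by simpa [hi] using h i
          refine ⟨fun i => ?_, ?_⟩
          · by_cases hi : i ∈ T
            · exact Or.inr (h1 i hi)
            · exact Or.inl (h2 i hi)
          · ext i
            rw [mem_unitSupport]
            refine ⟨fun hi => ?_, h1 i⟩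
            by_contra hT
            rw [h2 i hT] at hi
            exact not_isUnit_zero hi
    _ = ∏ i ∈ T, Nat.card (R i)ˣ := by
        rw [Fintype.card_piFinset, ← prod_subset (subset_univ T)]
        · exact prod_congr rfl fun i hi => by rw [if_pos hi, hu]
        · intro i _ hi
          rw [if_neg hi, card_singleton]

theorem mem_inducedCliqueComplex {V : Type*} {G : SimpleGraph V} {S : Set V} {s : Finset V} :
    s ∈ inducedCliqueComplex G S ↔ s.Nonempty ∧ (s : Set V) ⊆ S ∧ G.IsClique (s : Set V) :=
  Iff.rfl

theorem mul_eq_zero_iff_forall (e : A ≃+* ∀ i, R i) (x y : A) :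
    x * y = 0 ↔ ∀ i, e x i * e y i = 0 := by
  rw [← e.map_eq_zero_iff, map_mul, funext_iff]
  rfl

/-- The cliques of nonzero elements in which every coordinate of some member is a unit are the
families of elements with coordinates zero or a unit whose supports partition the coordinates. -/
theorem mem_nonzeroComplex_and_forall_exists_isUnit_iff [Fintype ι] [DecidableEq ι] [DecidableEq A]
    [Nonempty ι] [Finite A] [∀ i, Nontrivial (R i)] (e : A ≃+* ∀ i, R i) (s : Finset A) (m : ℕ) :
    ((s ∈ nonzeroComplex A ∧ ∀ i, ∃ x ∈ s, IsUnit (e x i)) ∧ #s = m) ↔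
      s ∈ supportPartitions (zeroOrUnitElements e) (unitSupport e) univ m := by
  rw [nonzeroComplex, mem_inducedCliqueComplex, mem_supportPartitions]
  constructor
  · rintro ⟨⟨⟨-, h0, hcl⟩, hu⟩, hm⟩
    have hmul : ∀ x ∈ s, ∀ y ∈ s, x ≠ y → ∀ i, e x i * e y i = 0 := fun x hx y hy hxy =>
      (mul_eq_zero_iff_forall e x y).1 (hcl hx hy hxy).2
    have hX : ∀ y ∈ s, ∀ i, e y i = 0 ∨ IsUnit (e y i) := by
      intro y hy i
      obtain ⟨x, hx, hxu⟩ := hu i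
      by_cases hxy : x = y
      · exact Or.inr (hxy ▸ hxu)
      · exact Or.inl (hxu.mul_right_eq_zero.1 (hmul x hx y hy hxy i))
    refine ⟨fun y hy => mem_zeroOrUnitElements.2 (hX y hy), ?_, ?_, ?_, hm⟩
    · intro x hx y hy hxy
      refine disjoint_left.2 fun i hi hj => ?_
      rw [mem_unitSupport] at hi hj
      have := hi.mul hj
      rw [hmul x hx y hy hxy i] at this
      exact not_isUnit_zero this
    · intro x hx
      by_contra hne
      rw [not_nonempty_iff_eq_empty] at hne
      refine h0 hx (e.map_eq_zero_iff.1 (funext fun i => ?_))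
      refine (hX x hx i).resolve_right fun h => ?_
      have := mem_unitSupport.2 h
      simp [hne] at this
    · refine eq_univ_of_forall fun i => ?_
      obtain ⟨x, hx, hxu⟩ := hu i
      exact mem_biUnion.2 ⟨x, hx, mem_unitSupport.2 hxu⟩
  · rintro ⟨hX, hd, hne, hT, hm⟩
    have hu : ∀ i, ∃ x ∈ s, IsUnit (e x i) := fun i => by
      obtain ⟨x, hx, hxi⟩ := mem_biUnion.1 (hT ▸ mem_univ i)
      exact ⟨x, hx, mem_unitSupport.1 hxi⟩
    obtain ⟨x, hx, -⟩ := hu (Classical.arbitrary ι)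
    refine ⟨⟨⟨⟨x, hx⟩, ?_, ?_⟩, hu⟩, hm⟩
    · rintro y hy rfl
      obtain ⟨i, hi⟩ := hne 0 hy
      rw [mem_unitSupport, map_zero] at hi
      exact not_isUnit_zero hi
    · intro x hx y hy hxy
      refine ⟨hxy, (mul_eq_zero_iff_forall e x y).2 fun i => ?_⟩
      rcases mem_zeroOrUnitElements.1 (hX hx) i with h | h
      · rw [h, zero_mul]
      rcases mem_zeroOrUnitElements.1 (hX hy) i with h' | h'
      · rw [h', mul_zero]
      exact absurd (mem_unitSupport.2 h') (disjoint_left.1 (hd hx hy hxy) (mem_unitSupport.2 h))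

/-- The Betti numbers of a full subcomplex of `K₀(A)` that contains all zero-divisors, for a product
`A` of finite local rings that are not fields, count the cliques in which every coordinate of some
member is a unit. -/
theorem reducedBetti_inducedCliqueComplex_beckGraph [Finite ι] [Nonempty ι] [Finite A] [LinearOrder A]
    [∀ i, Finite (R i)] [∀ i, IsLocalRing (R i)] (e : A ≃+* ∀ i, R i)
    (hR : ∀ i, ¬ IsField (R i)) {S : Set A} (hS : nonzeroZeroDivisors A ⊆ S)
    (hS0 : S ⊆ {a | a ≠ 0}) (n : ℕ) :
    reducedBetti (inducedCliqueComplex (beckGraph A) S) n =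
      Nat.card {s : Finset A // (s ∈ inducedCliqueComplex (beckGraph A) S ∧
        ∀ i, ∃ x ∈ s, IsUnit (e x i)) ∧ #s = n + 1} := by
  classical
  choose s hs0 hsu hs using fun i => exists_ne_zero_mul_nonunit_eq_zero (R i) (hR i)
  set z : ι → A := fun i => e.symm (Pi.single i (s i)) with hz
  have hez : ∀ i, e (z i) = Pi.single i (s i) := fun i => e.apply_symm_apply _
  have hz0 : ∀ i, z i ≠ 0 := fun i h => hs0 i <| by
    have := congrFun (hez i) i
    rw [h, map_zero, Pi.single_eq_same] at this
    exact this.symm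
  have hzE : ∀ i j, ¬ IsUnit (e (z j) i) := fun i j => by
    rw [hez]
    by_cases h : i = j
    · subst h
      rw [Pi.single_eq_same]
      exact hsu i
    · rw [Pi.single_eq_of_ne h]
      exact not_isUnit_zero
  have hmul : ∀ i y, ¬ IsUnit (e y i) → z i * y = 0 := fun i y hy => by
    rw [mul_eq_zero_iff_forall e, hez]
    intro j
    by_cases h : j = i
    · subst h
      rw [Pi.single_eq_same, hs j _ hy]
    · rw [Pi.single_eq_of_ne h, zero_mul]
  rw [reducedBetti_eq_card_of_cones (E := fun i x => ¬ IsUnit (e x i)) (z := z) _ hzE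
    ?_ ?_ inferInstance]
  · simp only [not_not]
  · rintro i σ hσ hE
    refine ⟨insert_nonempty _ _, ?_, ?_⟩
    · rw [coe_insert, Set.insert_subset_iff]
      -- The apex squares to zero, so it is a zero-divisor and belongs to `S`.
      refine ⟨hS ⟨hz0 i, z i, hz0 i, hmul i _ (hzE i i)⟩, ?_⟩
      rcases hσ with hσ | rfl
      · exact hσ.2.1
      · simp
    · rw [coe_insert, SimpleGraph.isClique_insert]
      refine ⟨?_, fun y hy hne => ⟨hne, hmul i y (hE y hy)⟩⟩
      rcases hσ with hσ | rfl
      · exact hσ.2.2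
      · simp
  · intro σ hσ x hx
    by_contra! h
    refine hS0 (hσ.2.1 hx) (e.map_eq_zero_iff.1 (funext fun i => ?_))
    obtain ⟨y, hy, hyu⟩ := h i
    rw [mem_erase] at hy
    exact hyu.mul_right_eq_zero.1
      ((mul_eq_zero_iff_forall e y x).1 (hσ.2.2 hy.2 hx hy.1).2 i)

theorem reducedBetti_nonzeroComplex [Fintype ι] [Nonempty ι] [Finite A] [LinearOrder A]
    [∀ i, Finite (R i)] [∀ i, IsLocalRing (R i)] (e : A ≃+* ∀ i, R i)
    (hR : ∀ i, ¬ IsField (R i)) (n : ℕ) :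
    reducedBetti (nonzeroComplex A) n =
      partitionCount (n + 1) (Fintype.card ι) * ∏ i, Nat.card (R i)ˣ := by
  classical
  rw [nonzeroComplex, reducedBetti_inducedCliqueComplex_beckGraph (S := {a | a ≠ 0}) e hR
      (fun x hx => hx.1) le_rfl,
    ← nonzeroComplex]
  simp_rw [mem_nonzeroComplex_and_forall_exists_isUnit_iff e]
  rw [Nat.card_eq_fintype_card, Fintype.card_coe,
    card_supportPartitions _ _ _ (card_filter_unitSupport_eq e), card_univ]

/-- Each vertex of a clique with at least two vertices is killed by another nonzero vertex. The two
complexes can differ only in isolated vertices. -/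
theorem mem_zeroDivisorComplex_iff_of_one_lt_card {s : Finset A} (hs : 1 < #s) :
    s ∈ zeroDivisorComplex A ↔ s ∈ nonzeroComplex A := by
  refine ⟨fun h => ⟨h.1, fun x hx => (h.2.1 hx).1, h.2.2⟩, fun h => ⟨h.1, fun x hx => ?_, h.2.2⟩⟩
  obtain ⟨y, hy, hyx⟩ := exists_mem_ne hs x
  exact ⟨h.2.1 hx, y, h.2.1 hy, (h.2.2 hx hy hyx.symm).2⟩

theorem reducedBetti_zeroDivisorComplex [Finite ι] [Nonempty ι] [Finite A] [LinearOrder A]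
    [∀ i, Finite (R i)] [∀ i, IsLocalRing (R i)] (e : A ≃+* ∀ i, R i)
    (hR : ∀ i, ¬ IsField (R i)) {n : ℕ} (hn : 1 ≤ n) :
    reducedBetti (zeroDivisorComplex A) n = reducedBetti (nonzeroComplex A) n := by
  rw [nonzeroComplex, reducedBetti_inducedCliqueComplex_beckGraph (S := {a | a ≠ 0}) e hR
      (fun x hx => hx.1) le_rfl,
    zeroDivisorComplex, reducedBetti_inducedCliqueComplex_beckGraph e hR le_rfl (fun x hx => hx.1)]
  refine Nat.card_congr (Equiv.subtypeEquivRight fun s => and_congr_left fun hs =>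
    and_congr_left fun _ => ?_)
  exact mem_zeroDivisorComplex_iff_of_one_lt_card (by omega)

/-- A critical simplex with one vertex would be a unit of `A`, hence not a zero-divisor. -/
theorem reducedBetti_zeroDivisorComplex_zero [Finite ι] [Nonempty ι] [Finite A] [LinearOrder A]
    [∀ i, Finite (R i)] [∀ i, IsLocalRing (R i)] (e : A ≃+* ∀ i, R i)
    (hR : ∀ i, ¬ IsField (R i)) : reducedBetti (zeroDivisorComplex A) 0 = 0 := by
  rw [zeroDivisorComplex,
    reducedBetti_inducedCliqueComplex_beckGraph e hR le_rfl (fun x hx => hx.1), Nat.card_eq_zero]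
  refine Or.inl ⟨?_⟩
  rintro ⟨s, ⟨hs, hu⟩, hc⟩
  obtain ⟨x, rfl⟩ := card_eq_one.1 hc
  obtain ⟨-, y, hy, hxy⟩ := hs.2.1 (mem_coe.2 (mem_singleton_self x))
  refine hy (e.map_eq_zero_iff.1 (funext fun i => ?_))
  obtain ⟨x', hx', hxu⟩ := hu i
  rw [mem_singleton.1 hx'] at hxu
  exact hxu.mul_right_eq_zero.1 ((mul_eq_zero_iff_forall e x y).1 hxy i)

end Rings

end ZeroDivisorHomology

end

theorem mainTheorem4 :
    ∃ a : ℕ → ℕ → ℤ,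
      (∀ k : ℕ, 1 ≤ k → a 0 k = 1) ∧
      (∀ n k : ℕ, 1 ≤ n → 1 ≤ k →
        a n k = ∑ j ∈ Finset.Icc 1 (k - 1), ((k - 1).choose j : ℤ) * a (n - 1) j) ∧
      ∀ (k : ℕ) (_ : 1 ≤ k)
        (Ω : Type*) [CommRing Ω] [Finite Ω] [LinearOrder Ω]
        (R : Fin k → Type*) [∀ i, CommRing (R i)] [∀ i, Finite (R i)] [∀ i, IsLocalRing (R i)]
        (_ : Ω ≃+* (∀ i, R i)) (_ : ∀ i, ¬ IsField (R i)),
        (∀ n : ℕ, 1 ≤ n →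
          (ZeroDivisorHomology.reducedBetti (ZeroDivisorHomology.zeroDivisorComplex Ω) n : ℤ) =
            a n k * ∏ i, (Nat.card (R i)ˣ : ℤ)) ∧
        (∀ n : ℕ,
          (ZeroDivisorHomology.reducedBetti (ZeroDivisorHomology.nonzeroComplex Ω) n : ℤ) =
            a n k * ∏ i, (Nat.card (R i)ˣ : ℤ)) ∧
        ZeroDivisorHomology.reducedBetti (ZeroDivisorHomology.zeroDivisorComplex Ω) 0 = 0 := by
  -- The shift arises because an `n`-simplex has `n + 1` vertices, one per block.
  refine ⟨fun n k => ZeroDivisorHomology.partitionCount (n + 1) k, fun k hk => ?_,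
    fun n k hn hk => ?_, ?_⟩
  · simp [ZeroDivisorHomology.partitionCount_one hk]
  · obtain ⟨n, rfl⟩ := Nat.exists_eq_add_of_le' hn
    simp [ZeroDivisorHomology.partitionCount_add_two n hk]
  · intro k hk Ω _ _ _ R _ _ _ e hR
    have : Nonempty (Fin k) := ⟨⟨0, hk⟩⟩
    refine ⟨fun n hn => ?_, fun n => ?_,
      ZeroDivisorHomology.reducedBetti_zeroDivisorComplex_zero e hR⟩
    · rw [ZeroDivisorHomology.reducedBetti_zeroDivisorComplex e hR hn,
        ZeroDivisorHomology.reducedBetti_nonzeroComplex e hR]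
      simp
    · rw [ZeroDivisorHomology.reducedBetti_nonzeroComplex e hR]
      simp
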